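/- **Definitions.** A *generalized effect algebra* (GEA) is a set $E$ with an element $0$ and a partial binary operation $\oplus$ such that: if $e\oplus f$ is defined, so is $f\oplus e$ and they are equal; if $d\oplus(e\oplus f)$ is defined, so is $(d\oplus e)\oplus f$ and they are equal; $e\oplus 0=e$; $d\oplus e=d\oplus f$ implies $e=f$; $e\oplus f=0$ implies $e=f=0$. Write $e\perp f$ if $e\oplus f$ is defined, and $e\le f$ if $e\oplus d=f$ for some $d$ (then $f\ominus e:=d$); this is a partial order. Put $E[0,p]=\{e: e\le p\}$. A family is *orthogonal* if all its finite subfamilies have an orthosum, and *orthosummable* if it is orthogonal and the supremum of its finite partial orthosums exists; this supremum is its *orthosum*. $E$ is *Dedekind orthocomplete* if every orthogonal family whose finite partial orthosums are bounded above is orthosummable. An *order ideal* is a nonempty $S\subseteq E$ such that $t\le s\in S$ implies $t\in S$; it is an *ideal* if moreover $s,t\in S$, $s\perp t$ imply $s\oplus t\in S$. An element $p$ is *principal* if $e,f\le p$, $e\perp f$ imply $e\oplus f\le p$. The *exocenter* $\mathrm{GEX}(E)$ is the set of all $\pi:E\to E$ such that $e\perp f$ implies $\pi e\perp\pi f$ and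 $\pi(e\oplus f)=\pi e\oplus \pi f$; $\pi\pi e=\pi e$; $\pi e\le e$; and $\pi e=e$, $\pi f=0$ imply $e\perp f$. It is ordered by $\pi\le\xi$ iff $\pi\circ\xi=\pi$, with least element the zero mapping; put $\pi'e:=e\ominus\pi e$. A family $(e_i)$ in $E$ is *$\mathrm{GEX}$-orthogonal* if there is a pairwise disjoint family $(\pi_i)$ in $\mathrm{GEX}(E)$ with $e_i=\pi_ie_i$ for all $i$. $E$ is *centrally orthocomplete* if every $\mathrm{GEX}$-orthogonal family is orthosummable and every element orthogonal to all its members is orthogonal to its orthosum. For an equivalence relation $\sim$ on $E$, elements $e,f$ are *related* if there are nonzero $e_1\le e$, $f_1\le f$ with $e_1\sim f_1$, and *unrelated* otherwise; $\pi\in\mathrm{GEX}(E)$ *splits* $\sim$ if $e\in\pi(E)$, $f\in\pi'(E)$, $e\sim f$ imply $e=f=0$; $\Sigma_\sim(E)$ is the set of all such $\pi$. The relation $\sim$ is a *dimension equivalence relation* if: (SK1) $e\sim0$ implies $e=0$; (SK2) if $(e_i)_{i\in I}$, $(f_i)_{i\in I}$ are orthosummable and $e_i\sim f_i$ for all $i$,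 then $\bigoplus_i e_i\sim\bigoplus_i f_i$; (SK3d) if $p\sim s\oplus t$, then $p=e\oplus f$ for some $e\sim s$, $f\sim t$; (SK3e) if $e\oplus f=s\oplus t$, then there are $e=e_1\oplus e_2$, $f=f_1\oplus f_2$ with $s\sim e_1\oplus f_1$ and $t\sim e_2\oplus f_2$; (SK4a) if $e\not\perp f$, then $e$ and $f$ are related; (SK4b) if $e\not\le f$, there are nonzero $e_1,d_1$ with $e\ge e_1\sim d_1\perp f$; (SK4a$'$) if $e$ and $f$ are unrelated, there is $\pi\in\Sigma_\sim(E)$ with $e\in\pi(E)$ and $f\in\pi'(E)$. A *dimension generalized effect algebra* (DGEA) is a centrally orthocomplete and Dedekind orthocomplete GEA $E$ with a dimension equivalence relation $\sim$. For $e\in E$ let $\eta_e$ be the smallest $\pi\in\Sigma_\sim(E)$ with $\pi e=e$. For $T\subseteq E$ let $[T]_\eta$ be the set of all orthosums of families $(t_i)$ in $T$ such that the $\eta_{t_i}$ are pairwise disjoint in $\mathrm{GEX}(E)$, and let $T^\eta=\{\eta_et: e\in E, t\in T\}$. $T$ is *$\eta$-type determining* ($\eta$TD) if $T=[T]_\eta=T^\eta$,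 and *strongly $\eta$-type determining* ($\eta$STD) if $T$ is an order ideal and $T=[T]_\eta$. $T$ is *hereditary* if $e\sim h_1\le h\in T$ implies $e\in T$. An element $k$ is *simple* if every $e\le k$ is unrelated to $k\ominus e$; $f$ is *finite* if $e\le f$, $e\sim f$ imply $e=f$; $c$ is *invariant* if it is principal and $c\ge e_1\sim f\perp c$ implies $e_1=f=0$; $c$ is *$\eta$-invariant* if $\eta_c(E)=E[0,c]$. **Theorem.** Let $E$ be a DGEA with dimension equivalence relation $\sim$. Then $\eta_e$ exists for every $e\in E$, and: (i) the set $K$ of all simple elements is a hereditary order ideal and an $\eta$STD set; (ii) the set $F$ of all finite elements is a hereditary ideal and an $\eta$STD set; (iii) the set $\widetilde F$ of all finite invariant elements coincides with the set of all finite $\eta$-invariant elements, and it is an $\eta$TD set. -/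

import Mathlib

universe u

/-- A generalized effect algebra: a set with a zero and a partial binary operation `oplus`
(`oplus e f = some g` means that `e ⊕ f` is defined and equals `g`; `oplus e f = none` means
that `e ⊕ f` is undefined) which is commutative, associative, has `0` as a neutral element,
and is cancellative and positive. -/
class GEA (E : Type u) extends Zero E where
  oplus : E → E → Option E
  oplus_comm : ∀ {e f s : E}, oplus e f = some s → oplus f e = some s
  oplus_assoc : ∀ {d e f s t : E}, oplus e f = some s → oplus d s = some t →
    ∃ r, oplus d e = some r ∧ oplus r f = some t
  oplus_zero : ∀ e : E, oplus e 0 = some e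
  oplus_cancel : ∀ {d e f s : E}, oplus d e = some s → oplus d f = some s → e = f
  oplus_pos : ∀ {e f : E}, oplus e f = some 0 → e = 0 ∧ f = 0

namespace GEA

variable {E : Type u} [GEA E]

/-- `e ⊥ f`: the orthosum `e ⊕ f` is defined. -/
def Perp (e f : E) : Prop := ∃ s, oplus e f = some s

theorem zero_oplus (e : E) : oplus 0 e = some e := oplus_comm (oplus_zero e)

/-- The other direction of associativity. -/
theorem oplus_assoc' {d e f r t : E} (h₁ : oplus d e = some r) (h₂ : oplus r f = some t) :
    ∃ s, oplus e f = some s ∧ oplus d s = some t := by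
  obtain ⟨s, hs, ht⟩ := oplus_assoc (oplus_comm h₁) (oplus_comm h₂)
  exact ⟨s, oplus_comm hs, oplus_comm ht⟩

theorem eq_zero_of_oplus_eq {a b : E} (h : oplus a b = some a) : b = 0 :=
  oplus_cancel h (oplus_zero a)

/-- The partial order of a generalized effect algebra: `e ≤ f` iff `e ⊕ d = f` for some `d`. -/
instance instPartialOrder : PartialOrder E where
  le e f := ∃ d, oplus e d = some f
  le_refl e := ⟨0, oplus_zero e⟩
  le_trans := by
    rintro a b c ⟨x, hx⟩ ⟨y, hy⟩
    obtain ⟨s, -, hs⟩ := oplus_assoc' hx hy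
    exact ⟨s, hs⟩
  le_antisymm := by
    rintro a b ⟨x, hx⟩ ⟨y, hy⟩
    obtain ⟨s, hxy, hs⟩ := oplus_assoc' hx hy
    obtain rfl := eq_zero_of_oplus_eq hs
    obtain ⟨rfl, rfl⟩ := oplus_pos hxy
    rw [oplus_zero] at hx
    exact Option.some.inj hx

theorem le_def {e f : E} : e ≤ f ↔ ∃ d, oplus e d = some f := Iff.rfl

/-! ### Orthogonal and orthosummable families -/

/-- `IsFinOrthosum e S s`: the finite subfamily `(e i)`, `i ∈ S`, is orthogonal with orthosum `s`
(the orthosum of a finite family is formed by adding one member after the other; by commutativity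
and associativity the order is irrelevant). -/
inductive IsFinOrthosum {I : Type u} (e : I → E) : Finset I → E → Prop
  | empty : IsFinOrthosum e ∅ 0
  | cons {S : Finset I} {s t : E} (i : I) (hi : i ∉ S) (hS : IsFinOrthosum e S s)
      (ht : oplus s (e i) = some t) : IsFinOrthosum e (Finset.cons i S hi) t

/-- The set of all finite partial orthosums of a family. -/
def partialOrthosums {I : Type u} (e : I → E) : Set E := {s | ∃ S, IsFinOrthosum e S s}

/-- A family is orthogonal iff each of its finite subfamilies has an orthosum. -/
def Orthogonal {I : Type u} (e : I → E) : Prop := ∀ S : Finset I, ∃ s, IsFinOrthosum e S s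

/-- The family `e` is orthosummable with orthosum `s`. -/
def IsOrthosum {I : Type u} (e : I → E) (s : E) : Prop :=
  Orthogonal e ∧ IsLUB (partialOrthosums e) s

variable (E) in
/-- `E` is Dedekind orthocomplete. -/
def DedekindOrthocomplete : Prop :=
  ∀ (I : Type u) (e : I → E), Orthogonal e → BddAbove (partialOrthosums e) → ∃ s, IsOrthosum e s

/-! ### Order ideals, ideals, principal elements -/

/-- Order ideals are nonempty down-sets. -/
def IsOrderIdeal (S : Set E) : Prop := S.Nonempty ∧ ∀ s ∈ S, ∀ t, t ≤ s → t ∈ S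

/-- An ideal is an order ideal that is closed under existing orthosums of two elements. -/
def IsIdeal (S : Set E) : Prop :=
  IsOrderIdeal S ∧ ∀ s ∈ S, ∀ t ∈ S, ∀ r, oplus s t = some r → r ∈ S

/-- `p` is principal iff `e, f ≤ p` and `e ⊥ f` imply `e ⊕ f ≤ p`. -/
def IsPrincipal (p : E) : Prop := ∀ e f s, e ≤ p → f ≤ p → oplus e f = some s → s ≤ p

/-! ### The exocenter -/

variable (E) in
/-- The exocenter of `E`: the idempotent decreasing endomorphisms `π` of `E` such that
`π e = e` and `π f = 0` imply `e ⊥ f`. -/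
@[ext]
structure Exocenter where
  toFun : E → E
  map_oplus : ∀ {e f s : E}, oplus e f = some s → oplus (toFun e) (toFun f) = some (toFun s)
  idem : ∀ e, toFun (toFun e) = toFun e
  decr : ∀ e, toFun e ≤ e
  perp : ∀ e f, toFun e = e → toFun f = 0 → Perp e f

namespace Exocenter

instance : CoeFun (Exocenter E) (fun _ => E → E) := ⟨toFun⟩

theorem map_mono (π : Exocenter E) {a b : E} (h : a ≤ b) : π a ≤ π b := by
  obtain ⟨d, hd⟩ := h
  exact ⟨π d, π.map_oplus hd⟩

/-- Subelements of fixed elements are fixed. -/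
theorem fixed_of_le (π : Exocenter E) {a b : E} (h : a ≤ b) (hb : π b = b) : π a = a := by
  obtain ⟨y, hy⟩ := h
  obtain ⟨c, hc⟩ := π.decr a
  obtain ⟨x, hx⟩ := π.decr y
  have h1 := π.map_oplus hy
  rw [hb] at h1
  -- now `π a ⊕ π y = b` and `b ⊕ (x ⊕ c) = b`
  obtain ⟨s, hs1, hs2⟩ := oplus_assoc' (oplus_comm hc) hy
  obtain ⟨r, hr1, hr2⟩ := oplus_assoc hx hs1
  rw [h1, Option.some.injEq] at hr1
  subst hr1
  obtain ⟨m, hm1, hm2⟩ := oplus_assoc' hr2 (oplus_comm hs2)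
  obtain rfl := eq_zero_of_oplus_eq hm2
  obtain ⟨-, rfl⟩ := oplus_pos hm1
  rw [oplus_zero] at hc
  exact Option.some.inj hc

/-- Any two mappings in the exocenter commute. -/
theorem comm_apply (π ξ : Exocenter E) (e : E) : π (ξ e) = ξ (π e) := by
  obtain ⟨x, hx⟩ := π.decr e
  have hπx : π x = 0 := by
    have h := π.map_oplus hx
    rw [π.idem] at h
    exact eq_zero_of_oplus_eq h
  have h1 : π (ξ (π e)) = ξ (π e) := π.fixed_of_le (ξ.decr _) (π.idem e)
  have h2 : π (ξ x) = 0 := by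
    obtain ⟨y, hy⟩ := π.map_mono (ξ.decr x)
    rw [hπx] at hy
    exact (oplus_pos hy).1
  have h3 := π.map_oplus (ξ.map_oplus hx)
  rw [h1, h2, oplus_zero] at h3
  exact (Option.some.inj h3).symm

/-- `π ≤ ξ` iff `π ∘ ξ = π`. -/
instance : PartialOrder (Exocenter E) where
  le π ξ := ∀ e, π (ξ e) = π e
  le_refl π := π.idem
  le_trans π ξ ρ h₁ h₂ e := by rw [← h₁, h₂, h₁]
  le_antisymm π ξ h₁ h₂ := by
    ext e
    exact (h₁ e).symm.trans ((comm_apply π ξ e).trans (h₂ e))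

/-- The least element of the exocenter is the zero mapping. -/
instance : OrderBot (Exocenter E) where
  bot :=
    { toFun := fun _ => 0
      map_oplus := fun _ => oplus_zero 0
      idem := fun _ => rfl
      decr := fun e => ⟨e, zero_oplus e⟩
      perp := by
        rintro e f rfl -
        exact ⟨f, zero_oplus f⟩ }
  bot_le _ _ := rfl

/-- The direct summand `π(E)`. -/
def summand (π : Exocenter E) : Set E := Set.range π

/-- The complementary direct summand `π'(E) = {e ⊖ π e : e ∈ E}`. -/
def coSummand (π : Exocenter E) : Set E := {f | ∃ e, oplus (π e) f = some e}

end Exocenter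

/-- A pairwise disjoint family in the exocenter: `π i ∧ π j = 0` for `i ≠ j`. -/
def PairwiseDisjoint {I : Type u} (π : I → Exocenter E) : Prop :=
  ∀ i j, i ≠ j → Disjoint (π i) (π j)

/-- Families that are orthogonal with respect to the exocenter. -/
def ExoOrthogonal {I : Type u} (e : I → E) : Prop :=
  ∃ π : I → Exocenter E, PairwiseDisjoint π ∧ ∀ i, e i = π i (e i)

variable (E) in
/-- `E` is centrally orthocomplete (a COGEA). -/
structure CentrallyOrthocomplete : Prop where
  co1 : ∀ (I : Type u) (e : I → E), ExoOrthogonal e → ∃ s, IsOrthosum e s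
  co2 : ∀ (I : Type u) (e : I → E) (s d : E), ExoOrthogonal e → IsOrthosum e s →
    (∀ i, Perp d (e i)) → Perp d s

/-! ### Dimension equivalence relations -/

/-- `e` and `f` are related: they have nonzero equivalent subelements. -/
def Related (sim : E → E → Prop) (e f : E) : Prop :=
  ∃ e₁ f₁, e₁ ≠ 0 ∧ f₁ ≠ 0 ∧ e₁ ≤ e ∧ sim e₁ f₁ ∧ f₁ ≤ f

/-- `f` is sub-equivalent to `e`. -/
def SubEquiv (sim : E → E → Prop) (f e : E) : Prop := ∃ e₁, e₁ ≤ e ∧ sim f e₁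

/-- `H` is hereditary with respect to `sim`. -/
def IsHereditary (sim : E → E → Prop) (H : Set E) : Prop :=
  ∀ h ∈ H, ∀ e, SubEquiv sim e h → e ∈ H

/-- A Sherstnev-Kalinin congruence on `E`. -/
structure IsSKCongruence (sim : E → E → Prop) : Prop where
  equiv : Equivalence sim
  sk1 : ∀ e, sim e 0 → e = 0
  sk2 : ∀ (I : Type u) (e f : I → E) (s t : E), IsOrthosum e s → IsOrthosum f t →
    (∀ i, sim (e i) (f i)) → sim s t
  sk3d : ∀ p s t r, oplus s t = some r → sim p r →
    ∃ e f, oplus e f = some p ∧ sim e s ∧ sim f t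
  sk3e : ∀ e f s t r, oplus e f = some r → oplus s t = some r →
    ∃ e₁ e₂ f₁ f₂ x y, oplus e₁ e₂ = some e ∧ oplus f₁ f₂ = some f ∧
      oplus e₁ f₁ = some x ∧ sim s x ∧ oplus e₂ f₂ = some y ∧ sim t y
  sk4a : ∀ e f, ¬ Perp e f → ∃ e₁ f₁, e₁ ≠ 0 ∧ f₁ ≠ 0 ∧ e₁ ≤ e ∧ sim e₁ f₁ ∧ f₁ ≤ f
  sk4b : ∀ e f, ¬ e ≤ f → ∃ e₁ d₁, e₁ ≠ 0 ∧ d₁ ≠ 0 ∧ e₁ ≤ e ∧ sim e₁ d₁ ∧ Perp d₁ f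

/-- The set of all mappings in the exocenter that split `sim`. -/
def splitting (sim : E → E → Prop) : Set (Exocenter E) :=
  {π | ∀ e f, e ∈ π.summand → f ∈ π.coSummand → sim e f → e = 0 ∧ f = 0}

/-- A dimension equivalence relation (DER) on `E`. -/
structure IsDER (sim : E → E → Prop) : Prop extends IsSKCongruence sim where
  sk4a' : ∀ e f, ¬ Related sim e f → ∃ π ∈ splitting sim, e ∈ π.summand ∧ f ∈ π.coSummand

/-- `E`, equipped with `sim`, is a dimension generalized effect algebra (DGEA). -/
structure IsDGEA (sim : E → E → Prop) : Prop where
  centrallyOrthocomplete : CentrallyOrthocomplete E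
  dedekindOrthocomplete : DedekindOrthocomplete E
  isDER : IsDER sim

/-! ### Hull systems and type determining sets -/

/-- `η` is the hull system determined by a set `Θ` of mappings in the exocenter: `η e` is the
smallest `θ ∈ Θ` with `θ e = e`. -/
def IsHullSystemOf (Θ : Set (Exocenter E)) (η : E → Exocenter E) : Prop :=
  ∀ e, IsLeast {θ | θ ∈ Θ ∧ θ e = e} (η e)

open Classical in
/-- The hull system determined by the set of all mappings that split `sim`: the value at `e` is
the smallest such mapping that fixes `e` (and the zero mapping if there is no smallest one). -/
noncomputable def hull (sim : E → E → Prop) (e : E) : Exocenter E :=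
  if h : ∃ π, IsLeast {θ | θ ∈ splitting sim ∧ θ e = e} π then h.choose else ⊥

/-- `[T]_η`: the set of all orthosums of `η`-orthogonal families in `T`. -/
def bracket (η : E → Exocenter E) (T : Set E) : Set E :=
  {s | ∃ (I : Type u) (t : I → E), (∀ i, t i ∈ T) ∧ PairwiseDisjoint (fun i => η (t i)) ∧
    IsOrthosum t s}

/-- `T^η = {η_e t : e ∈ E, t ∈ T}`. -/
def hullImages (η : E → Exocenter E) (T : Set E) : Set E := {s | ∃ e, ∃ t ∈ T, s = η e t}

/-- `T` is `η`-type determining (`η`TD). -/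
def IsTypeDetermining (η : E → Exocenter E) (T : Set E) : Prop :=
  T = bracket η T ∧ T = hullImages η T

/-- `T` is strongly `η`-type determining (`η`STD). -/
def IsStronglyTypeDetermining (η : E → Exocenter E) (T : Set E) : Prop :=
  IsOrderIdeal T ∧ T = bracket η T

/-! ### Simple, finite and invariant elements -/

/-- The set `K` of all simple elements: `k` is simple iff each `e ≤ k` is unrelated
to `k ⊖ e`. -/
def simpleElements (sim : E → E → Prop) : Set E :=
  {k | ∀ e d, oplus e d = some k → ¬ Related sim e d}

/-- The set `F` of all finite elements: `f` is finite iff `e ≤ f` and `e ∼ f` imply `e = f`. -/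
def finiteElements (sim : E → E → Prop) : Set E := {f | ∀ e, e ≤ f → sim e f → e = f}

/-- The set of all invariant elements: `c` is invariant iff it is principal and
`c ≥ e₁ ∼ f ⊥ c` implies `e₁ = f = 0`. -/
def invariantElements (sim : E → E → Prop) : Set E :=
  {c | IsPrincipal c ∧ ∀ e₁ f, e₁ ≤ c → sim e₁ f → Perp f c → e₁ = 0 ∧ f = 0}

/-- The set of all `η`-invariant elements: `η_c(E) = E[0,c]`. -/
def hullInvariantElements (η : E → Exocenter E) : Set E :=
  {c | (η c).summand = Set.Iic c}

/-- The set `F̃` of all finite invariant elements. -/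
def finiteInvariantElements (sim : E → E → Prop) : Set E :=
  finiteElements sim ∩ invariantElements sim

end GEA

/-! Adjoining an absorbing "undefined" element turns the partial operation into a commutative
monoid, so finite orthosums become `Finset` sums and infinite ones are suprema of such sums.

Splitting mappings preserve `sim` (`IsSKCongruence.map_sim`) and are closed under complements,
compositions and suprema of disjoint families. The complement of the supremum of a maximal disjoint
family of splitting mappings killing `e` is therefore the hull of `e`.

If `s` is the orthosum of a hull-orthogonal family `t`, then the hull of `t i` maps `s` to `t i`,
and a part of `s` killed by all these hulls is zero. A defect in the simplicity or finiteness of `s`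
would thus already occur in some `t i`.

The hard point is that `s ⊕ t` is finite when `s` and `t` are. Otherwise it contains an infinite
sequence of equivalent nonzero elements. The even and odd terms yield a decomposition `a ⊕ b'` of `s
⊕ t`, which (SK3e) refines against `s` and `t`. Generalized comparability of the two crossing pieces
gives a splitting `π` for which `π a` is sub-equivalent to `s` and `π' b'` to `t`. Both are then
finite, which forces `π` and `π'` to kill the sequence.

Invariance and `η`-invariance agree even without finiteness: (SK4a') makes every nonzero part of the
hull of `c` related to `c`. -/

namespace GEA

variable {E : Type u} [GEA E]

/-! ### The total monoid of a generalized effect algebra -/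

instance instZeroOption : Zero (Option E) := ⟨some 0⟩

instance instAddOption : Add (Option E) := ⟨fun x y => x.bind fun a => y.bind fun b => oplus a b⟩

/-- Adjoining an absorbing element `none` (for undefined orthosums) to a generalized effect
algebra makes the partial operation total. -/
instance instAddCommMonoidOption : AddCommMonoid (Option E) where
  nsmul := nsmulRec
  add_assoc x y z := by
    change (x.bind fun a => y.bind fun b => oplus a b).bind (fun a => z.bind fun b => oplus a b) =
      x.bind fun a => (y.bind fun a => z.bind fun b => oplus a b).bind fun b => oplus a b
    rcases x with - | d
    · rfl
    rcases y with - | e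
    · rfl
    rcases z with - | f
    · simp
    ext t
    simp only [Option.bind_some, Option.bind_eq_some_iff]
    constructor
    · rintro ⟨r, h₁, h₂⟩
      exact oplus_assoc' h₁ h₂
    · rintro ⟨r, h₁, h₂⟩
      exact oplus_assoc h₁ h₂
  add_comm x y := by
    change (x.bind fun a => y.bind fun b => oplus a b) = y.bind fun a => x.bind fun b => oplus a b
    rcases x with - | a <;> rcases y with - | b <;> try rfl
    ext t
    exact ⟨oplus_comm, oplus_comm⟩
  zero_add x := by
    rcases x with - | a
    · rfl
    · exact zero_oplus a
  add_zero x := by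
    rcases x with - | a
    · rfl
    · exact oplus_zero a

theorem some_add_some (a b : E) : some a + some b = oplus a b := rfl

theorem some_zero : (some 0 : Option E) = 0 := rfl

theorem exists_of_add_eq_some {x y : Option E} {s : E} (h : x + y = some s) :
    ∃ a b, x = some a ∧ y = some b ∧ oplus a b = some s := by
  rcases x with - | a
  · cases h
  rcases y with - | b
  · rw [add_comm] at h
    cases h
  exact ⟨a, b, rfl, rfl, h⟩

theorem le_of_some_add {a b : E} {y : Option E} (h : some a + y = some b) : a ≤ b := by
  obtain ⟨a', d, h₁, -, h₂⟩ := exists_of_add_eq_some h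
  cases h₁
  exact ⟨d, h₂⟩

theorem exists_some_add_of_le {a b : E} (h : a ≤ b) : ∃ d : E, some a + some d = some b := h

theorem zero_le' (a : E) : 0 ≤ a := ⟨a, zero_oplus a⟩

theorem eq_zero_of_le_zero {a : E} (h : a ≤ 0) : a = 0 := le_antisymm h (zero_le' a)

theorem exists_oplus_of_le {a b a' b' s : E} (ha : a' ≤ a) (hb : b' ≤ b)
    (h : oplus a b = some s) : ∃ t, oplus a' b' = some t ∧ t ≤ s := by
  obtain ⟨x, hx⟩ := exists_some_add_of_le ha
  obtain ⟨y, hy⟩ := exists_some_add_of_le hb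
  have h' : some a' + some b' + (some x + some y) = some s := by
    rw [add_add_add_comm, hx, hy]
    exact h
  obtain ⟨t, -, ht, -, -⟩ := exists_of_add_eq_some h'
  exact ⟨t, ht, le_of_some_add (ht ▸ h')⟩

theorem le_of_oplus_le {a b c s t : E} (hb : oplus a b = some s) (hc : oplus a c = some t)
    (h : t ≤ s) : c ≤ b := by
  obtain ⟨x, hx⟩ := exists_some_add_of_le h
  have h' : some a + (some c + some x) = some s := by
    rw [← add_assoc, some_add_some, hc, hx]
  obtain ⟨a', y, h₁, hy, h₂⟩ := exists_of_add_eq_some h'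
  cases h₁
  obtain rfl := oplus_cancel h₂ hb
  exact le_of_some_add hy

theorem eq_zero_of_oplus_le {a b s : E} (h : oplus a b = some s) (hs : s ≤ a) : b = 0 :=
  eq_zero_of_le_zero (le_of_oplus_le (oplus_zero a) h hs)

/-- Suprema can be taken separately in the two arguments of a bounded orthosum. -/
theorem exists_oplus_of_isLUB {A B : Set E} {a b s : E} (hA : IsLUB A a) (hB : IsLUB B b)
    (hA₀ : A.Nonempty) (hB₀ : B.Nonempty)
    (h : ∀ x ∈ A, ∀ y ∈ B, ∃ t, oplus x y = some t ∧ t ≤ s) :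
    ∃ t, oplus a b = some t ∧ t ≤ s := by
  have key : ∀ {A B : Set E} {a : E}, IsLUB A a → A.Nonempty →
      (∀ x ∈ A, ∀ y ∈ B, ∃ t, oplus x y = some t ∧ t ≤ s) →
      ∀ y ∈ B, ∃ t, oplus a y = some t ∧ t ≤ s := by
    intro A B a hA hA₀ h y hy
    obtain ⟨x₀, hx₀⟩ := hA₀
    obtain ⟨t₀, ht₀, hts⟩ := h x₀ hx₀ y hy
    -- Here `y ⊕ c = s`. By cancellation `c` bounds all of `A`, so it also bounds the supremum `a`.
    obtain ⟨c, hc⟩ := (show y ≤ t₀ from ⟨x₀, oplus_comm ht₀⟩).trans hts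
    have hac : a ≤ c := hA.2 fun x hx => by
      obtain ⟨t, ht, h⟩ := h x hx y hy
      exact le_of_oplus_le hc (oplus_comm ht) h
    exact exists_oplus_of_le hac le_rfl (oplus_comm hc)
  obtain h₁ := key hA hA₀ h
  obtain ⟨t, ht, hts⟩ := key hB hB₀ (B := {a}) (fun y hy x hx => by
    obtain rfl := hx
    obtain ⟨t, ht, hts⟩ := h₁ y hy
    exact ⟨t, oplus_comm ht, hts⟩) a rfl
  exact ⟨t, oplus_comm ht, hts⟩

/-! ### Orthosums as sums in the total monoid -/

/-- Gives access to the `Finset.sum` lemmas for reindexing, splitting and adding finite orthosums.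
-/
theorem isFinOrthosum_iff {I : Type u} {e : I → E} {S : Finset I} {s : E} :
    IsFinOrthosum e S s ↔ ∑ i ∈ S, some (e i) = some s := by
  constructor
  · intro h
    induction h with
    | empty => rfl
    | cons i hi hS ht ih => rw [Finset.sum_cons, ih, add_comm, some_add_some, ht]
  · induction S using Finset.cons_induction generalizing s with
    | empty =>
      intro h
      cases h
      exact .empty
    | cons i S hi ih =>
      intro h
      rw [Finset.sum_cons, add_comm] at h
      obtain ⟨a, b, ha, hb, hab⟩ := exists_of_add_eq_some h
      cases hb
      exact .cons i hi (ih ha) hab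

theorem isOrthosum_iff {I : Type u} {e : I → E} {s : E} :
    IsOrthosum e s ↔ (∀ S : Finset I, ∃ t, ∑ i ∈ S, some (e i) = some t ∧ t ≤ s) ∧
      ∀ u, (∀ (S : Finset I) (t : E), ∑ i ∈ S, some (e i) = some t → t ≤ u) → s ≤ u := by
  constructor
  · rintro ⟨ho, hs⟩
    refine ⟨fun S => ?_, fun u hu => hs.2 ?_⟩
    · obtain ⟨t, ht⟩ := ho S
      exact ⟨t, isFinOrthosum_iff.1 ht, hs.1 ⟨S, ht⟩⟩
    · rintro t ⟨S, hS⟩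
      exact hu S t (isFinOrthosum_iff.1 hS)
  · rintro ⟨h₁, h₂⟩
    refine ⟨fun S => ?_, ?_, fun u hu => h₂ u fun S t ht => hu ⟨S, isFinOrthosum_iff.2 ht⟩⟩
    · obtain ⟨t, ht, -⟩ := h₁ S
      exact ⟨t, isFinOrthosum_iff.2 ht⟩
    · rintro t ⟨S, hS⟩
      obtain ⟨t', ht', h⟩ := h₁ S
      obtain rfl := Option.some.inj ((isFinOrthosum_iff.1 hS).symm.trans ht')
      exact h

theorem partialOrthosums_nonempty {I : Type u} (e : I → E) : (partialOrthosums e).Nonempty :=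
  ⟨0, ∅, .empty⟩

theorem IsOrthosum.le {I : Type u} {e : I → E} {s : E} (h : IsOrthosum e s) (i : I) : e i ≤ s := by
  obtain ⟨t, ht, hts⟩ := (isOrthosum_iff.1 h).1 {i}
  rw [Finset.sum_singleton, Option.some.injEq] at ht
  exact ht ▸ hts

theorem IsOrthosum.unique {I : Type u} {e : I → E} {s t : E} (hs : IsOrthosum e s)
    (ht : IsOrthosum e t) : s = t := hs.2.unique ht.2

theorem isOrthosum_of_fintype {I : Type u} [Fintype I] {e : I → E} {s : E}
    (h : ∑ i, some (e i) = some s) : IsOrthosum e s := by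
  classical
  refine isOrthosum_iff.2 ⟨fun S => ?_, fun u hu => hu _ _ h⟩
  rw [← Finset.sum_add_sum_compl S] at h
  obtain ⟨t, -, ht, -, -⟩ := exists_of_add_eq_some h
  exact ⟨t, ht, le_of_some_add (ht ▸ h)⟩

theorem isOrthosum_punit (t : E) : IsOrthosum (fun _ : PUnit.{u + 1} => t) t :=
  isOrthosum_of_fintype (by simp)

theorem isOrthosum_bool {a b s : E} (h : oplus a b = some s) :
    IsOrthosum (fun i : ULift.{u} Bool => cond i.down a b) s := by
  refine isOrthosum_of_fintype ?_
  rw [← Equiv.ulift.symm.sum_comp, Fintype.sum_bool]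
  exact h

/-- In a Dedekind orthocomplete algebra, a family with bounded finite partial orthosums is
orthosummable. -/
theorem DedekindOrthocomplete.exists_isOrthosum (hD : DedekindOrthocomplete E) {I : Type u}
    {e : I → E} {r : E} (h : ∀ S : Finset I, ∃ t, ∑ i ∈ S, some (e i) = some t ∧ t ≤ r) :
    ∃ s, IsOrthosum e s ∧ s ≤ r := by
  have hb : r ∈ upperBounds (partialOrthosums e) := by
    rintro t ⟨S, hS⟩
    obtain ⟨t', ht', h⟩ := h S
    obtain rfl := Option.some.inj ((isFinOrthosum_iff.1 hS).symm.trans ht')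
    exact h
  obtain ⟨s, hs⟩ := hD I e (fun S => (h S).imp fun t ht => isFinOrthosum_iff.2 ht.1) ⟨r, hb⟩
  exact ⟨s, hs, hs.2.2 hb⟩

/-- A Dedekind orthocomplete algebra is archimedean. -/
theorem DedekindOrthocomplete.eq_zero_of_nsmul_le (hD : DedekindOrthocomplete E) {a r : E}
    (h : ∀ n : ℕ, ∃ t, n • some a = some t ∧ t ≤ r) : a = 0 := by
  obtain ⟨s, hs, -⟩ := hD.exists_isOrthosum (I := ULift.{u} ℕ) (e := fun _ => a) (r := r)
    (fun S => by simpa using h S.card)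
  have hns : ∀ n : ℕ, ∃ t, n • some a = some t ∧ t ≤ s := fun n => by
    obtain ⟨t, ht⟩ := (isOrthosum_iff.1 hs).1 ((Finset.range n).map Equiv.ulift.symm.toEmbedding)
    exact ⟨t, by simpa using ht⟩
  -- Write `s = a ⊕ c`. Since `(n + 1) a ≤ s`, cancellation gives `n a ≤ c` for all `n`, so `s ≤ c`
  -- and `a = 0`.
  obtain ⟨c, hc⟩ := hs.le ⟨0⟩
  have hsc : s ≤ c := (isOrthosum_iff.1 hs).2 c fun S t ht => by
    obtain ⟨v, hv, hvs⟩ := hns (S.card + 1)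
    rw [Finset.sum_const] at ht
    rw [succ_nsmul', ht] at hv
    exact le_of_oplus_le hc hv hvs
  exact eq_zero_of_oplus_le (oplus_comm hc) hsc

/-! ### The exocenter -/

namespace Exocenter

theorem map_zero (π : Exocenter E) : π 0 = 0 := eq_zero_of_le_zero (π.decr 0)

theorem mem_summand_iff {π : Exocenter E} {e : E} : e ∈ π.summand ↔ π e = e := by
  constructor
  · rintro ⟨x, rfl⟩
    exact π.idem x
  · exact fun h => ⟨e, h⟩

theorem mem_coSummand_iff {π : Exocenter E} {f : E} : f ∈ π.coSummand ↔ π f = 0 := by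
  constructor
  · rintro ⟨e, h⟩
    have h' := π.map_oplus h
    rw [π.idem] at h'
    exact eq_zero_of_oplus_eq h'
  · exact fun h => ⟨f, by rw [h, zero_oplus]⟩

theorem eq_zero_of_le (π : Exocenter E) {a b : E} (h : a ≤ b) (hb : π b = 0) : π a = 0 :=
  eq_zero_of_le_zero (hb ▸ π.map_mono h)

/-- The mapping `e ↦ e ⊖ π e`. -/
noncomputable def complFun (π : Exocenter E) (e : E) : E := (π.decr e).choose

theorem oplus_complFun (π : Exocenter E) (e : E) : oplus (π e) (π.complFun e) = some e :=
  (π.decr e).choose_spec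

theorem complFun_eq_self {π : Exocenter E} {e : E} (h : π e = 0) : π.complFun e = e := by
  have h' := π.oplus_complFun e
  rw [h, zero_oplus] at h'
  exact Option.some.inj h'

/-- The complement `π'` of `π`. -/
noncomputable def compl (π : Exocenter E) : Exocenter E where
  toFun := π.complFun
  map_oplus {e f s} h := by
    have h₁ : some (π e) + some (π f) = some (π s) := π.map_oplus h
    have h₂ : some (π s) + (some (π.complFun e) + some (π.complFun f)) = some s := by
      rw [← h₁, add_add_add_comm, some_add_some, oplus_complFun, some_add_some, oplus_complFun,
        some_add_some, h]
    obtain ⟨p, y, hp, hy, h₃⟩ := exists_of_add_eq_some h₂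
    cases hp
    obtain rfl := oplus_cancel h₃ (π.oplus_complFun s)
    exact hy
  idem e := complFun_eq_self (mem_coSummand_iff.1 ⟨e, π.oplus_complFun e⟩)
  decr e := ⟨π e, oplus_comm (π.oplus_complFun e)⟩
  perp e f he hf := by
    have hf' := π.oplus_complFun f
    rw [hf, oplus_zero, Option.some.injEq] at hf'
    obtain ⟨s, hs⟩ := π.perp f e hf' (by
      rw [← he]
      exact mem_coSummand_iff.1 ⟨e, π.oplus_complFun e⟩)
    exact ⟨s, oplus_comm hs⟩

theorem oplus_compl (π : Exocenter E) (e : E) : oplus (π e) (π.compl e) = some e :=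
  π.oplus_complFun e

theorem apply_compl (π : Exocenter E) (e : E) : π (π.compl e) = 0 :=
  mem_coSummand_iff.1 ⟨e, π.oplus_compl e⟩

theorem compl_eq_self_iff {π : Exocenter E} {e : E} : π.compl e = e ↔ π e = 0 := by
  constructor
  · intro h
    rw [← h, apply_compl]
  · intro h
    have h' := π.oplus_compl e
    rw [h, zero_oplus] at h'
    exact Option.some.inj h'

theorem compl_eq_zero_iff {π : Exocenter E} {e : E} : π.compl e = 0 ↔ π e = e := by
  have h' := π.oplus_compl e
  constructor
  · intro h
    rw [h, oplus_zero] at h'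
    exact Option.some.inj h'
  · intro h
    rw [h] at h'
    exact eq_zero_of_oplus_eq h'

/-- The composition of two mappings in the exocenter, which is their infimum. -/
def comp (π ξ : Exocenter E) : Exocenter E where
  toFun e := π (ξ e)
  map_oplus h := π.map_oplus (ξ.map_oplus h)
  idem e := by rw [comm_apply ξ π (ξ e), ξ.idem, π.idem]
  decr e := (π.decr _).trans (ξ.decr e)
  perp e f he hf := by
    have hξe : ξ e = e := by rw [← he, comm_apply, ξ.idem]
    have hπe : π e = e := by rw [← he, π.idem]
    obtain ⟨s, hs⟩ := π.perp e (ξ f) hπe hf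
    have hξs : ξ s = s := by
      have h := ξ.map_oplus hs
      rw [ξ.idem, hξe, hs] at h
      exact (Option.some.inj h).symm
    obtain ⟨t, ht⟩ := ξ.perp s (ξ.compl f) hξs (ξ.apply_compl f)
    obtain ⟨r, hr, hrt⟩ := oplus_assoc' hs ht
    rw [oplus_compl, Option.some.injEq] at hr
    exact ⟨t, hr ▸ hrt⟩

theorem comp_apply (π ξ : Exocenter E) (e : E) : π.comp ξ e = π (ξ e) := rfl

theorem bot_apply (e : E) : (⊥ : Exocenter E) e = 0 := rfl

theorem disjoint_iff {π ξ : Exocenter E} : Disjoint π ξ ↔ ∀ e, π (ξ e) = 0 := by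
  constructor
  · intro h e
    have h' : π.comp ξ ≤ ⊥ := h
      (fun x => by rw [comp_apply, comp_apply, comm_apply ξ π, π.idem])
      (fun x => by rw [comp_apply, comp_apply, ξ.idem])
    have := h' e
    rw [bot_apply, map_zero] at this
    exact this.symm
  · intro h ρ h₁ h₂ x
    rw [bot_apply, map_zero, ← h₂ x, ← h₁, h, map_zero]

/-- Mappings in the exocenter preserve orthosums of arbitrary families. -/
theorem map_isOrthosum (π : Exocenter E) {I : Type u} {e : I → E} {s : E} (h : IsOrthosum e s) :
    IsOrthosum (fun i => π (e i)) (π s) := by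
  have hmap : ∀ (S : Finset I) (t : E), ∑ i ∈ S, some (e i) = some t →
      ∑ i ∈ S, some (π (e i)) = some (π t) := by
    intro S
    induction S using Finset.cons_induction with
    | empty =>
      intro t ht
      cases ht
      rw [map_zero]
      rfl
    | cons i S hi ih =>
      intro t ht
      rw [Finset.sum_cons] at ht ⊢
      obtain ⟨a, b, ha, hb, hab⟩ := exists_of_add_eq_some ht
      cases ha
      rw [ih b hb]
      exact π.map_oplus hab
  rw [isOrthosum_iff] at h ⊢
  refine ⟨fun S => ?_, fun u hu => ?_⟩
  · obtain ⟨t, ht, hts⟩ := h.1 S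
    exact ⟨π t, hmap S t ht, π.map_mono hts⟩
  -- The element `v = π u ⊕ π' s` bounds every partial orthosum `t = π t ⊕ π' t` of `e`. Hence `s ≤
  -- v`, and applying `π` gives `π s ≤ π u`.
  · obtain ⟨v, hv⟩ := π.perp (π u) (π.compl s) (π.idem u) (π.apply_compl s)
    have hsv : s ≤ v := h.2 v fun S t ht => by
      obtain ⟨t', ht', hts⟩ := h.1 S
      obtain rfl := Option.some.inj (ht.symm.trans ht')
      have h₁ : π t ≤ π u := by
        rw [← π.idem t]
        exact π.map_mono (hu S _ (hmap S t ht))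
      have h₂ : π.compl t ≤ π.compl s := π.compl.map_mono hts
      obtain ⟨w, hw, hwv⟩ := exists_oplus_of_le h₁ h₂ hv
      rw [oplus_compl, Option.some.injEq] at hw
      exact hw ▸ hwv
    have h₃ := π.map_oplus hv
    rw [π.idem, apply_compl, oplus_zero, Option.some.injEq] at h₃
    exact (π.map_mono hsv).trans (h₃ ▸ π.decr u)

/-- The components `π i x` are peeled off one at a time. By disjointness, removing one leaves the
images under the other mappings unchanged. -/
theorem exists_sum_add_eq {I : Type u} {π : I → Exocenter E} (hπ : PairwiseDisjoint π) (x : E)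
    (S : Finset I) : ∃ y, ∑ i ∈ S, some (π i x) + some y = some x ∧
      ∀ j ∉ S, π j y = π j x := by
  induction S using Finset.cons_induction with
  | empty => exact ⟨x, by simp, fun _ _ => rfl⟩
  | cons i S hi ih =>
    obtain ⟨y, hy, hj⟩ := ih
    refine ⟨(π i).compl y, ?_, fun j hjS => ?_⟩
    · rw [Finset.sum_cons, add_comm (some _), add_assoc, ← hj i hi, some_add_some, oplus_compl, hy]
    · rw [Finset.mem_cons, not_or] at hjS
      have h := (π j).map_oplus ((π i).oplus_compl y)
      rw [disjoint_iff.1 (hπ j i hjS.1), zero_oplus, Option.some.injEq] at h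
      rw [h, hj j hjS.2]

/-- In a centrally orthocomplete algebra, a pairwise disjoint family in the exocenter has a
supremum, which is computed pointwise as an orthosum. -/
theorem exists_pointwise_sup (hC : CentrallyOrthocomplete E) {I : Type u} {π : I → Exocenter E}
    (hπ : PairwiseDisjoint π) : ∃ σ : Exocenter E, ∀ x, IsOrthosum (fun i => π i x) (σ x) := by
  have hexo : ∀ x, ExoOrthogonal fun i => π i x := fun x => ⟨π, hπ, fun i => ((π i).idem x).symm⟩
  choose σ hσ using fun x => hC.co1 I _ (hexo x)
  have hle : ∀ x, σ x ≤ x := fun x => (isOrthosum_iff.1 (hσ x)).2 x fun S t ht => by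
    obtain ⟨y, hy, -⟩ := exists_sum_add_eq hπ x S
    exact le_of_some_add (ht ▸ hy)
  have hπσ : ∀ i x, π i (σ x) = π i x := fun i x => by
    refine le_antisymm ((π i).map_mono (hle x)) ?_
    have h := (π i).map_mono ((hσ x).le i)
    rwa [(π i).idem] at h
  refine ⟨⟨σ, fun {x y z} hz => ?_, fun x => ?_, hle, fun x y hx hy => ?_⟩, hσ⟩
  · have hsum : ∀ S : Finset I,
        ∑ i ∈ S, some (π i x) + ∑ i ∈ S, some (π i y) = ∑ i ∈ S, some (π i z) := fun S => by
      rw [← Finset.sum_add_distrib]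
      exact Finset.sum_congr rfl fun i _ => (π i).map_oplus hz
    obtain ⟨u, hu, huz⟩ := exists_oplus_of_isLUB (s := σ z) (hσ x).2 (hσ y).2
      (partialOrthosums_nonempty _) (partialOrthosums_nonempty _) (by
        rintro a ⟨S, hS⟩ b ⟨T, hT⟩
        classical
        rw [isFinOrthosum_iff] at hS hT
        obtain ⟨c, hc, hcz⟩ := (isOrthosum_iff.1 (hσ z)).1 (S ∪ T)
        have h := hsum (S ∪ T)
        rw [← Finset.sum_sdiff (Finset.subset_union_left : S ⊆ S ∪ T), hS, add_comm _ (some a),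
          ← Finset.sum_sdiff (Finset.subset_union_right : T ⊆ S ∪ T) (f := fun i => some (π i y)),
          hT, add_comm _ (some b), add_add_add_comm, hc] at h
        obtain ⟨v, -, hv, -, -⟩ := exists_of_add_eq_some h
        exact ⟨v, hv, (le_of_some_add (hv ▸ h)).trans hcz⟩)
    have hzu : σ z ≤ u := (isOrthosum_iff.1 (hσ z)).2 u fun S t ht => by
      obtain ⟨a, ha, hax⟩ := (isOrthosum_iff.1 (hσ x)).1 S
      obtain ⟨b, hb, hby⟩ := (isOrthosum_iff.1 (hσ y)).1 S
      obtain ⟨w, hw, hwu⟩ := exists_oplus_of_le hax hby hu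
      have h := hsum S
      rw [ha, hb, some_add_some, hw, ht, Option.some.injEq] at h
      exact h ▸ hwu
    rw [hu, le_antisymm huz hzu]
  · have h := hσ (σ x)
    simp only [hπσ] at h
    exact h.unique (hσ x)
  · have h₀ : ∀ i, π i y = 0 := fun i => by rw [← hπσ, hy, map_zero]
    -- The second clause of central orthocompleteness passes from orthogonality to each `π i x` to
    -- orthogonality to their orthosum.
    obtain ⟨s, hs⟩ := hC.co2 I _ (σ x) y (hexo x) (hσ x) fun i => by
      obtain ⟨s, hs⟩ := (π i).perp (π i x) y ((π i).idem x) (h₀ i)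
      exact ⟨s, oplus_comm hs⟩
    rw [hx] at hs
    exact ⟨s, oplus_comm hs⟩

variable {I : Type u} {π : I → Exocenter E} {σ : Exocenter E}

theorem apply_pointwise_sup (hσ : ∀ x, IsOrthosum (fun i => π i x) (σ x)) (i : I) (x : E) :
    π i (σ x) = π i x := by
  refine le_antisymm ((π i).map_mono (σ.decr x)) ?_
  have h := (π i).map_mono ((hσ x).le i)
  rwa [(π i).idem] at h

theorem pointwise_sup_eq_zero (hσ : ∀ x, IsOrthosum (fun i => π i x) (σ x)) {x : E}
    (hx : ∀ i, π i x = 0) : σ x = 0 := by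
  refine eq_zero_of_le_zero ((isOrthosum_iff.1 (hσ x)).2 0 fun S t ht => ?_)
  simp only [hx, some_zero, Finset.sum_const_zero] at ht
  exact (Option.some.inj ht).ge

end Exocenter

variable {sim : E → E → Prop}

/-! ### Splitting mappings and their hull system -/

theorem IsSKCongruence.oplus_congr (h : IsSKCongruence sim) {a b s a' b' s' : E}
    (hs : oplus a b = some s) (hs' : oplus a' b' = some s') (ha : sim a a') (hb : sim b b') :
    sim s s' :=
  h.sk2 _ _ _ _ _ (isOrthosum_bool hs) (isOrthosum_bool hs') (by
    rintro ⟨_ | _⟩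
    · exact hb
    · exact ha)

theorem IsSKCongruence.exists_sim_of_le (h : IsSKCongruence sim) {a b c : E} (hab : sim a b)
    (hc : c ≤ b) : ∃ d, d ≤ a ∧ sim d c := by
  obtain ⟨x, hx⟩ := hc
  obtain ⟨e, f, hef, he, -⟩ := h.sk3d _ _ _ _ hx hab
  exact ⟨e, ⟨f, hef⟩, he⟩

theorem IsSKCongruence.eq_zero_of_sim (h : IsSKCongruence sim) {a b : E} (hab : sim a b)
    (ha : a = 0) : b = 0 :=
  h.sk1 b (h.equiv.symm (ha ▸ hab))

theorem mem_splitting_iff {π : Exocenter E} :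
    π ∈ splitting sim ↔ ∀ e f, π e = e → π f = 0 → sim e f → e = 0 ∧ f = 0 := by
  simp only [splitting, Set.mem_ofPred_eq, Exocenter.mem_summand_iff, Exocenter.mem_coSummand_iff]

/-- Mappings that split `sim` preserve `sim`. -/
theorem IsSKCongruence.map_sim (h : IsSKCongruence sim) {π : Exocenter E}
    (hπ : π ∈ splitting sim) {e f : E} (hef : sim e f) : sim (π e) (π f) := by
  rw [mem_splitting_iff] at hπ
  -- The decomposition `f = π f ⊕ π' f` is carried to `e = a ⊕ b`. As `π` splits `sim`, both `π b`
  -- and `π' a` vanish, so `a = π e`.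
  obtain ⟨a, b, hab, ha, hb⟩ := h.sk3d _ _ _ _ (π.oplus_compl f) hef
  have hπb : π b = 0 := by
    obtain ⟨c, hcb, hc⟩ := h.exists_sim_of_le (h.equiv.symm hb) (π.decr b)
    have hc0 := π.eq_zero_of_le hcb (π.apply_compl f)
    exact (hπ _ _ (π.idem b) hc0 (h.equiv.symm hc)).1
  have hπa : π.compl a = 0 := by
    obtain ⟨c, hca, hc⟩ := h.exists_sim_of_le (h.equiv.symm ha) (π.compl.decr a)
    exact (hπ _ _ (π.fixed_of_le hca (π.idem f)) (π.apply_compl a) hc).2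
  have hs := π.map_oplus hab
  rw [hπb, Exocenter.compl_eq_zero_iff.1 hπa, oplus_zero, Option.some.injEq] at hs
  exact hs ▸ ha

theorem IsSKCongruence.mem_splitting (h : IsSKCongruence sim) {π : Exocenter E}
    (hπ : ∀ e f, π e = e → π f = 0 → sim e f → e = 0) : π ∈ splitting sim :=
  mem_splitting_iff.2 fun e f he hf hef =>
    have h₀ := hπ e f he hf hef
    ⟨h₀, h.eq_zero_of_sim hef h₀⟩

theorem IsSKCongruence.compl_mem_splitting (h : IsSKCongruence sim) {π : Exocenter E}
    (hπ : π ∈ splitting sim) : π.compl ∈ splitting sim := by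
  rw [mem_splitting_iff] at hπ
  exact h.mem_splitting fun e f he hf hef => (hπ f e (Exocenter.compl_eq_zero_iff.1 hf)
    (Exocenter.compl_eq_self_iff.1 he) (h.equiv.symm hef)).2

theorem IsSKCongruence.comp_mem_splitting (h : IsSKCongruence sim) {π ξ : Exocenter E}
    (hπ : π ∈ splitting sim) (hξ : ξ ∈ splitting sim) : π.comp ξ ∈ splitting sim :=
  h.mem_splitting fun e f he hf hef => by
    have h' := h.map_sim hπ (h.map_sim hξ hef)
    rw [← Exocenter.comp_apply, ← Exocenter.comp_apply, he, hf] at h'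
    exact h.sk1 e h'

theorem IsSKCongruence.sup_mem_splitting (h : IsSKCongruence sim) {I : Type u}
    {π : I → Exocenter E} {σ : Exocenter E} (hσ : ∀ x, IsOrthosum (fun i => π i x) (σ x))
    (hπ : ∀ i, π i ∈ splitting sim) : σ ∈ splitting sim :=
  h.mem_splitting fun e f he hf hef => by
    rw [← he]
    refine Exocenter.pointwise_sup_eq_zero hσ fun i => ?_
    have h' := h.map_sim (hπ i) hef
    rw [← Exocenter.apply_pointwise_sup hσ i f, hf, Exocenter.map_zero] at h'
    exact h.sk1 _ h'

/-- Every element has a smallest splitting mapping fixing it. -/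
theorem exists_isLeast_splitting (hE : IsDGEA sim) (e : E) :
    ∃ π, IsLeast {θ | θ ∈ splitting sim ∧ θ e = e} π := by
  have hsim := hE.isDER.toIsSKCongruence
  obtain ⟨A, hA⟩ := zorn_subset
    {A : Set (Exocenter E) | (∀ ρ ∈ A, ρ ∈ splitting sim ∧ ρ e = 0) ∧ A.PairwiseDisjoint id} (by
      intro c hc hchain
      refine ⟨⋃₀ c, ⟨?_, ?_⟩, fun _ => Set.subset_sUnion_of_mem⟩
      · rintro ρ ⟨B, hB, hρ⟩
        exact (hc hB).1 ρ hρ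
      · exact (Set.pairwise_sUnion hchain.directedOn).2 fun B hB => (hc hB).2)
  have hdisj : PairwiseDisjoint fun ρ : A => ρ.1 := fun i j hij =>
    hA.prop.2 i.2 j.2 fun h => hij (Subtype.ext h)
  obtain ⟨σ, hσ⟩ := Exocenter.exists_pointwise_sup hE.centrallyOrthocomplete hdisj
  have hσe : σ e = 0 := Exocenter.pointwise_sup_eq_zero hσ fun i => (hA.prop.1 i.1 i.2).2
  have hσs := hsim.compl_mem_splitting (hsim.sup_mem_splitting hσ fun i => (hA.prop.1 i.1 i.2).1)
  refine ⟨σ.compl, ⟨hσs, Exocenter.compl_eq_self_iff.2 hσe⟩, fun θ hθ x => ?_⟩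
  -- This mapping kills `e` and is disjoint from every member of `A`, so maximality puts it into
  -- `A`. It then lies below both `σ` and `σ'`, hence is zero, which means `σ' ≤ θ`.
  have hτ : θ.compl.comp σ.compl ∈ A := by
    refine hA.le_of_ge ⟨?_, ?_⟩ (Set.subset_insert _ A) (Set.mem_insert _ A)
    · rintro ρ (rfl | hρ)
      · refine ⟨hsim.comp_mem_splitting (hsim.compl_mem_splitting hθ.1) hσs, ?_⟩
        rw [Exocenter.comp_apply, Exocenter.compl_eq_self_iff.2 hσe, Exocenter.compl_eq_zero_iff]
        exact hθ.2
      · exact hA.prop.1 ρ hρ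
    · refine hA.prop.2.insert fun ρ hρ _ => Exocenter.disjoint_iff.2 fun x => ?_
      simp only [id, Exocenter.comp_apply]
      rw [Exocenter.comm_apply σ.compl, ← Exocenter.apply_pointwise_sup hσ ⟨ρ, hρ⟩,
        Exocenter.apply_compl, Exocenter.map_zero, Exocenter.map_zero]
  have h₀ : θ.compl (σ.compl x) = 0 := by
    have h₁ := Exocenter.apply_pointwise_sup hσ ⟨_, hτ⟩ (σ.compl x)
    rw [Exocenter.apply_compl, Exocenter.map_zero] at h₁
    rw [h₁, Exocenter.comp_apply, σ.compl.idem]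
  rw [Exocenter.comm_apply, Exocenter.compl_eq_zero_iff.1 h₀]

theorem isHullSystemOf_hull (hE : IsDGEA sim) : IsHullSystemOf (splitting sim) (hull sim) := by
  intro e
  have h := exists_isLeast_splitting hE e
  rw [hull, dif_pos h]
  exact h.choose_spec

theorem hull_mem_splitting (hE : IsDGEA sim) (e : E) : hull sim e ∈ splitting sim :=
  (isHullSystemOf_hull hE e).1.1

theorem hull_self (hE : IsDGEA sim) (e : E) : hull sim e e = e := (isHullSystemOf_hull hE e).1.2

theorem hull_le (hE : IsDGEA sim) {e : E} {θ : Exocenter E} (hθ : θ ∈ splitting sim)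
    (h : θ e = e) : hull sim e ≤ θ :=
  (isHullSystemOf_hull hE e).2 ⟨hθ, h⟩

/-- The members of a hull-orthogonal family are recovered from its orthosum. -/
theorem hull_apply_orthosum (hE : IsDGEA sim) {I : Type u} {t : I → E} {s : E}
    (ht : PairwiseDisjoint fun i => hull sim (t i)) (hs : IsOrthosum t s) (i : I) :
    hull sim (t i) s = t i := by
  classical
  refine le_antisymm ?_ ?_
  · refine (isOrthosum_iff.1 ((hull sim (t i)).map_isOrthosum hs)).2 _ fun S r hr => ?_
    -- For `j ≠ i`, `t j` is fixed by its own hull, which is disjoint from that of `t i`.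
    have hterm : ∀ j, some (hull sim (t i) (t j)) = if j = i then some (t i) else 0 := fun j => by
      split_ifs with hj
      · rw [hj, hull_self hE]
      · rw [← hull_self hE (t j), Exocenter.disjoint_iff.1 (ht i j (Ne.symm hj)), some_zero]
    simp only [hterm, Finset.sum_ite_eq'] at hr
    split_ifs at hr
    · exact (Option.some.inj hr).ge
    · exact (Option.some.inj hr) ▸ zero_le' _
  · have h := (hull sim (t i)).map_mono (hs.le i)
    rwa [hull_self hE] at h

/-- The hulls of a hull-orthogonal family have a splitting supremum, which fixes the orthosum. -/
theorem exists_sup_hull (hE : IsDGEA sim) {I : Type u} {t : I → E} {s : E}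
    (ht : PairwiseDisjoint fun i => hull sim (t i)) (hs : IsOrthosum t s) :
    ∃ σ ∈ splitting sim, (∀ x, IsOrthosum (fun i => hull sim (t i) x) (σ x)) ∧ σ s = s := by
  obtain ⟨σ, hσ⟩ := Exocenter.exists_pointwise_sup hE.centrallyOrthocomplete ht
  refine ⟨σ, hE.isDER.toIsSKCongruence.sup_mem_splitting hσ fun i => hull_mem_splitting hE _, hσ,
    ?_⟩
  have h := hσ s
  simp only [hull_apply_orthosum hE ht hs] at h
  exact h.unique hs

theorem eq_zero_of_hull_apply_eq_zero (hE : IsDGEA sim) {I : Type u} {t : I → E} {s x : E}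
    (ht : PairwiseDisjoint fun i => hull sim (t i)) (hs : IsOrthosum t s) (hx : x ≤ s)
    (h : ∀ i, hull sim (t i) x = 0) : x = 0 := by
  obtain ⟨σ, -, hσ, hσs⟩ := exists_sup_hull hE ht hs
  rw [← σ.fixed_of_le hx hσs]
  exact Exocenter.pointwise_sup_eq_zero hσ h

theorem subset_bracket (η : E → Exocenter E) (T : Set E) : T ⊆ bracket η T := fun t ht =>
  ⟨PUnit, fun _ => t, fun _ => ht, fun _ _ h => (h rfl).elim, isOrthosum_punit t⟩

/-! ### Simple elements -/

theorem isOrderIdeal_simpleElements : IsOrderIdeal (simpleElements sim) := by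
  refine ⟨⟨0, ?_⟩, ?_⟩
  · rintro e d h ⟨e₁, -, he₁, -, hle, -, -⟩
    rw [(oplus_pos h).1] at hle
    exact he₁ (eq_zero_of_le_zero hle)
  · rintro s hs t ⟨r, hr⟩ e d hed ⟨e₁, d₁, he₁, hd₁, hle, hsim, hd⟩
    obtain ⟨v, hv, hev⟩ := oplus_assoc' hed hr
    exact hs e v hev ⟨e₁, d₁, he₁, hd₁, hle, hsim, hd.trans ⟨r, hv⟩⟩

theorem Related.congr (h : IsSKCongruence sim) {a b a' b' : E} (ha : sim a a') (hb : sim b b')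
    (hr : Related sim a b) : Related sim a' b' := by
  obtain ⟨x, y, hx, hy, hxa, hxy, hyb⟩ := hr
  obtain ⟨x', hx', hxx⟩ := h.exists_sim_of_le (h.equiv.symm ha) hxa
  obtain ⟨y', hy', hyy⟩ := h.exists_sim_of_le (h.equiv.symm hb) hyb
  exact ⟨x', y', fun h₀ => hx (h.eq_zero_of_sim hxx h₀), fun h₀ => hy (h.eq_zero_of_sim hyy h₀),
    hx', h.equiv.trans hxx (h.equiv.trans hxy (h.equiv.symm hyy)), hy'⟩

theorem isHereditary_simpleElements (h : IsSKCongruence sim) :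
    IsHereditary sim (simpleElements sim) := by
  rintro k hk e ⟨k₁, hk₁, hek⟩ a b hab hr
  obtain ⟨c, d, hcd, hc, hd⟩ := h.sk3d _ _ _ _ hab (h.equiv.symm hek)
  exact isOrderIdeal_simpleElements.2 k hk k₁ hk₁ c d hcd
    (hr.congr h (h.equiv.symm hc) (h.equiv.symm hd))

/-- Equivalent parts of complementary pieces of `s` are mapped by each hull to equivalent parts of
complementary pieces of `t i`, which must vanish. -/
theorem bracket_simpleElements_subset (hE : IsDGEA sim) :
    bracket (hull sim) (simpleElements sim) ⊆ simpleElements sim := by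
  rintro s ⟨I, t, htK, ht, hs⟩ e d hed ⟨e₁, d₁, he₁, -, hle, hsim, hd⟩
  refine he₁ (eq_zero_of_hull_apply_eq_zero hE ht hs (hle.trans ⟨d, hed⟩) fun i => ?_)
  by_contra h₀
  have hsum := (hull sim (t i)).map_oplus hed
  rw [hull_apply_orthosum hE ht hs] at hsum
  have hsim' := hE.isDER.toIsSKCongruence.map_sim (hull_mem_splitting hE (t i)) hsim
  exact htK i _ _ hsum ⟨_, _, h₀, fun h₁ => h₀ (hE.isDER.sk1 _ (h₁ ▸ hsim')),
    Exocenter.map_mono _ hle, hsim', Exocenter.map_mono _ hd⟩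

theorem isStronglyTypeDetermining_simpleElements (hE : IsDGEA sim) :
    IsStronglyTypeDetermining (hull sim) (simpleElements sim) :=
  ⟨isOrderIdeal_simpleElements, (subset_bracket _ _).antisymm (bracket_simpleElements_subset hE)⟩

/-! ### Comparability -/

/-- The finite subfamilies of `g`, indexed by elements of `P`, have orthosums below `r`. -/
def SumsBounded {J : Type u} (g : J → E) (P : Set J) (r : E) : Prop :=
  ∀ S : Finset J, ↑S ⊆ P → ∃ t, ∑ j ∈ S, some (g j) = some t ∧ t ≤ r

theorem SumsBounded.sUnion {J : Type u} {g : J → E} {r : E} {c : Set (Set J)}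
    (hc : IsChain (· ⊆ ·) c) (h : ∀ P ∈ c, SumsBounded g P r) : SumsBounded g (⋃₀ c) r := by
  intro S hS
  rcases c.eq_empty_or_nonempty with rfl | hne
  · rw [Set.sUnion_empty, Set.subset_empty_iff, Finset.coe_eq_empty] at hS
    exact ⟨0, by rw [hS]; rfl, zero_le' r⟩
  · obtain ⟨P, hP, hSP⟩ := hc.directedOn.exists_mem_subset_of_finset_subset_biUnion hne
      (by rwa [Set.sUnion_eq_biUnion] at hS)
    exact h P hP S hSP

theorem SumsBounded.exists_isOrthosum (hD : DedekindOrthocomplete E) {J : Type u} {g : J → E}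
    {P : Set J} {r : E} (h : SumsBounded g P r) :
    ∃ s, IsOrthosum (fun j : P => g j) s ∧ s ≤ r :=
  hD.exists_isOrthosum fun S => by
    obtain ⟨t, ht⟩ := h (S.map (Function.Embedding.subtype _)) (by simp)
    exact ⟨t, by simpa using ht⟩

theorem SumsBounded.insert {J : Type u} {g : J → E} {P : Set J} {r s d : E} {q : J}
    (hs : IsOrthosum (fun j : P => g j) s) (hr : oplus s d = some r) (hq : g q ≤ d) :
    SumsBounded g (insert q P) r := by
  classical
  have hP : ∀ S : Finset J, ↑S ⊆ P → ∃ t, ∑ j ∈ S, some (g j) = some t ∧ t ≤ s := fun S hS => by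
    obtain ⟨t, ht⟩ := (isOrthosum_iff.1 hs).1 (S.subtype (· ∈ P))
    rw [Finset.sum_subtype_of_mem (fun j => some (g j)) (fun j hj => hS hj)] at ht
    exact ⟨t, ht⟩
  intro S hS
  by_cases hqS : q ∈ S
  · obtain ⟨t, ht, hts⟩ := hP (S.erase q) fun j hj => by
      rw [Finset.coe_erase] at hj
      exact (hS hj.1).resolve_left hj.2
    obtain ⟨w, hw, hwr⟩ := exists_oplus_of_le hts hq hr
    rw [← Finset.sum_erase_add _ _ hqS, ht]
    exact ⟨w, hw, hwr⟩
  · obtain ⟨t, ht, hts⟩ := hP S fun j hj => (hS hj).resolve_left fun h => hqS (h ▸ hj)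
    exact ⟨t, ht, hts.trans ⟨d, hr⟩⟩

/-- Any two elements decompose into equivalent parts and unrelated remainders. -/
theorem exists_sim_unrelated (hE : IsDGEA sim) (e f : E) :
    ∃ x e₀ y f₀, oplus x e₀ = some e ∧ oplus y f₀ = some f ∧ sim x y ∧ ¬ Related sim e₀ f₀ := by
  have hD := hE.dedekindOrthocomplete
  -- The natural number is a label that lets the same equivalent pair occur repeatedly in a family.
  obtain ⟨P, hP⟩ := zorn_subset {P : Set (E × E × ℕ) | (∀ p ∈ P, sim p.1 p.2.1) ∧
      SumsBounded (fun p : E × E × ℕ => p.1) P e ∧ SumsBounded (fun p : E × E × ℕ => p.2.1) P f} (by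
    intro c hc hchain
    refine ⟨⋃₀ c, ⟨?_, .sUnion hchain fun B hB => (hc hB).2.1,
      .sUnion hchain fun B hB => (hc hB).2.2⟩, fun _ => Set.subset_sUnion_of_mem⟩
    rintro p ⟨B, hB, hp⟩
    exact (hc hB).1 p hp)
  obtain ⟨hPsim, hPe, hPf⟩ := hP.prop
  obtain ⟨x, hx, e₀, he₀⟩ := hPe.exists_isOrthosum hD
  obtain ⟨y, hy, f₀, hf₀⟩ := hPf.exists_isOrthosum hD
  refine ⟨x, e₀, y, f₀, he₀, hf₀, hE.isDER.sk2 _ _ _ _ _ hx hy fun p => hPsim p.1 p.2, ?_⟩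
  rintro ⟨a, b, ha, -, hae, hab, hbf⟩
  -- A related pair in the remainders could be added under any label, so by maximality all labels
  -- already occur. All multiples of `a` then lie below `e`, contrary to the archimedean property.
  have hmem : ∀ n : ℕ, (a, b, n) ∈ P := fun n =>
    hP.le_of_ge ⟨by
      rintro p (rfl | hp)
      · exact hab
      · exact hPsim p hp, .insert hx he₀ hae, .insert hy hf₀ hbf⟩
      (Set.subset_insert _ P) (Set.mem_insert _ P)
  refine ha (hD.eq_zero_of_nsmul_le (r := e) fun n => ?_)
  have h := hPe ((Finset.range n).map ⟨fun n => (a, b, n), fun m n h => by simpa using h⟩)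
    (by
      intro p hp
      rw [Finset.coe_map] at hp
      obtain ⟨n, -, rfl⟩ := hp
      exact hmem n)
  rw [Finset.sum_map] at h
  change ∃ t, ∑ _ ∈ Finset.range n, some a = some t ∧ t ≤ e at h
  rwa [Finset.sum_const, Finset.card_range] at h

/-- Generalized comparability. -/
theorem exists_splitting_subEquiv (hE : IsDGEA sim) (e f : E) :
    ∃ π ∈ splitting sim, SubEquiv sim (π f) (π e) ∧ SubEquiv sim (π.compl e) (π.compl f) := by
  have hsim := hE.isDER.toIsSKCongruence
  obtain ⟨x, e₀, y, f₀, he, hf, hxy, hr⟩ := exists_sim_unrelated hE e f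
  -- As `π` fixes `e₀` and kills `f₀`, it gives `π f = π y` and `π' e = π' x`.
  obtain ⟨π, hπ, he₀, hf₀⟩ := hE.isDER.sk4a' _ _ hr
  rw [Exocenter.mem_summand_iff, ← Exocenter.compl_eq_zero_iff] at he₀
  rw [Exocenter.mem_coSummand_iff] at hf₀
  have h₁ := π.map_oplus hf
  have h₂ := π.compl.map_oplus he
  rw [hf₀, oplus_zero, Option.some.injEq] at h₁
  rw [he₀, oplus_zero, Option.some.injEq] at h₂
  refine ⟨π, hπ, ⟨π x, π.map_mono ⟨e₀, he⟩, ?_⟩, ⟨π.compl y, π.compl.map_mono ⟨f₀, hf⟩, ?_⟩⟩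
  · rw [← h₁]
    exact hsim.equiv.symm (hsim.map_sim hπ hxy)
  · rw [← h₂]
    exact hsim.map_sim (hsim.compl_mem_splitting hπ) hxy

/-! ### Finite elements -/

theorem isOrderIdeal_finiteElements (h : IsSKCongruence sim) :
    IsOrderIdeal (finiteElements sim) := by
  refine ⟨⟨0, fun e he _ => eq_zero_of_le_zero he⟩, ?_⟩
  rintro s hs t ⟨r, hr⟩ t₁ ht₁ hsim
  obtain ⟨v, hv, hvs⟩ := exists_oplus_of_le ht₁ le_rfl hr
  obtain rfl := hs v hvs (h.oplus_congr hv hr hsim (h.equiv.refl r))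
  exact oplus_cancel (oplus_comm hv) (oplus_comm hr)

/-- By (SK3d), a proper part of `e` equivalent to `e` would induce such a part in the finite element
`f'`. -/
theorem isHereditary_finiteElements (h : IsSKCongruence sim) :
    IsHereditary sim (finiteElements sim) := by
  rintro f hf e ⟨f', hf', hef⟩ e₁ ⟨e₂, he⟩ hsim
  obtain ⟨a, b, hab, ha, hb⟩ := h.sk3d _ _ _ _ he (h.equiv.symm hef)
  have haf := (isOrderIdeal_finiteElements h).2 f hf f' hf' a ⟨b, hab⟩
    (h.equiv.trans ha (h.equiv.trans hsim hef))
  rw [haf] at hab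
  rw [h.eq_zero_of_sim hb (eq_zero_of_oplus_eq hab), oplus_zero] at he
  exact Option.some.inj he

/-- An element which is equivalent to a proper part of itself contains an infinite sequence of
pairwise equivalent nonzero elements. -/
theorem exists_seq_of_not_mem_finiteElements (h : IsSKCongruence sim) {r : E}
    (hr : r ∉ finiteElements sim) : ∃ x : ℕ → E, (∀ n, x n ≠ 0) ∧ (∀ m n, sim (x m) (x n)) ∧
      ∀ S : Finset ℕ, ∃ t, ∑ n ∈ S, some (x n) = some t ∧ t ≤ r := by
  classical
  simp only [finiteElements, Set.mem_ofPred_eq, not_forall] at hr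
  obtain ⟨r₁, ⟨x₀, hx₀⟩, hsim, hne⟩ := hr
  have hx₀ne : x₀ ≠ 0 := by
    rintro rfl
    rw [oplus_zero] at hx₀
    exact hne (Option.some.inj hx₀)
  -- Since `y ∼ r = r₁ ⊕ x₀`, (SK3d) splits off a copy of `x₀` and leaves an element equivalent to
  -- `r₁`, hence to `r`. The step can thus be iterated.
  have step : ∀ y : {y // sim y r}, ∃ z : {y // sim y r}, ∃ x, oplus z.1 x = some y.1 ∧
      sim x x₀ := fun y => by
    obtain ⟨a, b, hab, ha, hb⟩ := h.sk3d _ _ _ _ hx₀ y.2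
    exact ⟨⟨a, h.equiv.trans ha hsim⟩, b, hab, hb⟩
  choose next x hx hxsim using step
  let y : ℕ → {y // sim y r} := fun n => next^[n] ⟨r, h.equiv.refl r⟩
  have hy : ∀ n, oplus (y (n + 1)).1 (x (y n)) = some (y n).1 := fun n => by
    have : y (n + 1) = next (y n) := Function.iterate_succ_apply' _ _ _
    rw [this]
    exact hx _
  have hsum : ∀ n, ∑ i ∈ Finset.range n, some (x (y i)) + some (y n).1 = some r := fun n => by
    induction n with
    | zero => exact zero_add _
    | succ n ih =>
      rw [Finset.sum_range_succ, add_assoc, add_comm (some (x _)), some_add_some, hy, ih]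
  refine ⟨fun n => x (y n), fun n h₀ => hx₀ne (h.eq_zero_of_sim (hxsim (y n)) h₀),
    fun m n => h.equiv.trans (hxsim _) (h.equiv.symm (hxsim _)), fun S => ?_⟩
  obtain ⟨n, hn⟩ := S.exists_nat_subset_range
  have h' := hsum n
  rw [← Finset.sum_sdiff hn, add_comm (∑ i ∈ _ \ _, _), add_assoc] at h'
  obtain ⟨t, -, ht, -, -⟩ := exists_of_add_eq_some h'
  exact ⟨t, ht, le_of_some_add (ht ▸ h')⟩

/-- A direct summand of the orthosum of a sequence of pairwise equivalent elements is finite only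
if the terms of the sequence have no part in this summand. -/
theorem eq_zero_of_isOrthosum_mem_finiteElements (hE : IsDGEA sim) {x : ℕ → E}
    (hx : ∀ m n, sim (x m) (x n)) {s : E} (hs : IsOrthosum (fun n : ULift.{u} ℕ => x n.down) s)
    {π : Exocenter E} (hπ : π ∈ splitting sim) (hf : π s ∈ finiteElements sim) : π (x 0) = 0 := by
  classical
  have hsim := hE.isDER.toIsSKCongruence
  have hle : ∀ S : Finset ℕ, 0 ∉ S →
      ∃ t, ∑ n ∈ S, some (x n) = some t ∧ ∃ v, oplus (x 0) t = some v ∧ v ≤ s := fun S hS => by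
    obtain ⟨v, hv, hvs⟩ := (isOrthosum_iff.1 hs).1 ((insert 0 S).map Equiv.ulift.symm.toEmbedding)
    simp only [Finset.sum_map, Equiv.coe_toEmbedding, Equiv.ulift_symm_down,
      Finset.sum_insert hS] at hv
    obtain ⟨a, t, ha, ht, hat⟩ := exists_of_add_eq_some hv
    cases ha
    exact ⟨t, ht, v, hat, hvs⟩
  have hshift : ∀ S : Finset (ULift.{u} ℕ), ∃ t, ∑ n ∈ S, some (x (n.down + 1)) = some t ∧
      ∃ v, oplus (x 0) t = some v ∧ v ≤ s := fun S => by
    have h := hle (S.map ⟨fun n => n.down + 1, fun m n h => ULift.ext _ _ (by simpa using h)⟩)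
      (by simp)
    rwa [Finset.sum_map] at h
  obtain ⟨s', hs', -⟩ := hE.dedekindOrthocomplete.exists_isOrthosum
    (e := fun n : ULift.{u} ℕ => x (n.down + 1)) (r := s) fun S => by
      obtain ⟨t, ht, v, hv, hvs⟩ := hshift S
      exact ⟨t, ht, le_trans ⟨x 0, oplus_comm hv⟩ hvs⟩
  obtain ⟨w, hw, hws⟩ := exists_oplus_of_isLUB (s := s) isLUB_singleton hs'.2
    (Set.singleton_nonempty (x 0)) (partialOrthosums_nonempty _) (by
      rintro a rfl t ⟨S, hS⟩
      obtain ⟨t', ht', h⟩ := hshift S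
      obtain rfl := Option.some.inj ((isFinOrthosum_iff.1 hS).symm.trans ht')
      exact h)
  have h₁ : π s' ≤ π s := π.map_mono (le_trans ⟨x 0, oplus_comm hw⟩ hws)
  -- The shifted sequence is termwise equivalent to the original one, so `s' ∼ s` by (SK2), and
  -- finiteness forces equality. This leaves no room for `π (x 0)` beside `π s'` in `π s`.
  have h₂ : π s' = π s := hf _ h₁ (hsim.map_sim hπ (hE.isDER.sk2 _ _ _ _ _ hs' hs fun n => hx _ _))
  exact eq_zero_of_oplus_le (oplus_comm (π.map_oplus hw)) (h₂ ▸ π.map_mono hws)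

/-- If `a ∼ s₁ ⊕ t₁` where `π t₁` is sub-equivalent to `π s₂`, then `π a` is finite as soon as
`s₁ ⊕ s₂` is. -/
theorem apply_mem_finiteElements (h : IsSKCongruence sim) {s s₁ s₂ t₁ a x : E}
    (hs : s ∈ finiteElements sim) (hs₁₂ : oplus s₁ s₂ = some s) (hx : oplus s₁ t₁ = some x)
    (ha : sim a x) {π : Exocenter E} (hπ : π ∈ splitting sim)
    (hsub : SubEquiv sim (π t₁) (π s₂)) : π a ∈ finiteElements sim := by
  obtain ⟨u, hu, htu⟩ := hsub
  obtain ⟨v, hv, hvs⟩ := exists_oplus_of_le le_rfl hu (π.map_oplus hs₁₂)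
  exact isHereditary_finiteElements h s hs _ ⟨v, hvs.trans (π.decr s),
    h.equiv.trans (h.map_sim hπ ha) (h.oplus_congr (π.map_oplus hx) hv (h.equiv.refl _) htu)⟩

theorem isIdeal_finiteElements (hE : IsDGEA sim) : IsIdeal (finiteElements sim) := by
  classical
  have hsim := hE.isDER.toIsSKCongruence
  have hD := hE.dedekindOrthocomplete
  refine ⟨isOrderIdeal_finiteElements hsim, fun s hs t ht r hr => ?_⟩
  by_contra hrF
  obtain ⟨x, hx₀, hx, hxr⟩ := exists_seq_of_not_mem_finiteElements hsim hrF
  have hsub : ∀ (g : ℕ → ℕ) (hg : Function.Injective g) (S : Finset (ULift.{u} ℕ)),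
      ∑ n ∈ S, some (x (g n.down)) =
        ∑ n ∈ S.map (Equiv.ulift.toEmbedding.trans ⟨g, hg⟩), some (x n) := fun g hg S => by
    rw [Finset.sum_map]
    rfl
  have heven : Function.Injective fun n : ℕ => 2 * n := fun m n h => by simpa using h
  have hodd : Function.Injective fun n : ℕ => 2 * n + 1 := fun m n h => by simpa using h
  obtain ⟨a, ha, -⟩ := hD.exists_isOrthosum (e := fun n : ULift.{u} ℕ => x (2 * n.down)) (r := r)
    fun S => by rw [hsub _ heven]; exact hxr _
  obtain ⟨b, hb, -⟩ := hD.exists_isOrthosum (e := fun n : ULift.{u} ℕ => x (2 * n.down + 1))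
    (r := r) fun S => by rw [hsub _ hodd]; exact hxr _
  obtain ⟨c, hc, hcr⟩ := exists_oplus_of_isLUB (s := r) ha.2 hb.2 (partialOrthosums_nonempty _)
    (partialOrthosums_nonempty _) (by
      rintro p ⟨S, hS⟩ q ⟨T, hT⟩
      rw [isFinOrthosum_iff] at hS hT
      rw [hsub _ heven] at hS
      rw [hsub _ hodd] at hT
      obtain ⟨w, hw, hwr⟩ := hxr (S.map (Equiv.ulift.toEmbedding.trans ⟨_, heven⟩) ∪
        T.map (Equiv.ulift.toEmbedding.trans ⟨_, hodd⟩))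
      rw [Finset.sum_union, hS, hT] at hw
      · exact ⟨w, hw, hwr⟩
      · rw [Finset.disjoint_left]
        intro n hn hn'
        simp only [Finset.mem_map, Function.Embedding.trans_apply,
          Function.Embedding.coeFn_mk] at hn hn'
        obtain ⟨i, -, hi⟩ := hn
        obtain ⟨j, -, hj⟩ := hn'
        omega)
  obtain ⟨d, hd⟩ := hcr
  -- The remainder of `r` is absorbed into the odd part, so that `a ⊕ b' = r` exactly, as (SK3e)
  -- requires.
  obtain ⟨b', hb', hab'⟩ := oplus_assoc' hc hd
  obtain ⟨s₁, s₂, t₁, t₂, p, q, hs₁₂, ht₁₂, hp, hap, hq, hbq⟩ := hE.isDER.sk3e _ _ _ _ _ hr hab'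
  -- Here `a ∼ s₁ ⊕ t₁` and `b' ∼ s₂ ⊕ t₂`. Under `π` the piece `t₁` can be replaced by a part of
  -- `s₂`, and under `π'` conversely.
  obtain ⟨π, hπ, h₁, h₂⟩ := exists_splitting_subEquiv hE s₂ t₁
  have hπ' := hsim.compl_mem_splitting hπ
  have hz₁ : π (x 0) = 0 := eq_zero_of_isOrthosum_mem_finiteElements hE (x := fun n => x (2 * n))
    (fun _ _ => hx _ _) ha hπ (apply_mem_finiteElements hsim hs hs₁₂ hp hap hπ h₁)
  have hbf := apply_mem_finiteElements hsim ht (oplus_comm ht₁₂) (oplus_comm hq) hbq hπ' h₂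
  have hz₂ : π.compl (x 1) = 0 := eq_zero_of_isOrthosum_mem_finiteElements hE
    (x := fun n => x (2 * n + 1)) (fun _ _ => hx _ _) hb hπ'
    ((isOrderIdeal_finiteElements hsim).2 _ hbf _ (π.compl.map_mono ⟨d, hb'⟩))
  have hz₃ := hsim.eq_zero_of_sim (hsim.map_sim hπ' (hx 1 0)) hz₂
  rw [Exocenter.compl_eq_zero_iff, hz₁] at hz₃
  exact hx₀ 0 hz₃.symm

/-- If `s₁ ⊕ d = s ∼ s₁`, each hull carries this into the finite element `t i`, so it kills `d`. -/
theorem bracket_finiteElements_subset (hE : IsDGEA sim) :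
    bracket (hull sim) (finiteElements sim) ⊆ finiteElements sim := by
  rintro s ⟨I, t, htF, ht, hs⟩ s₁ ⟨d, hd⟩ hsim
  have hd₀ : d = 0 := eq_zero_of_hull_apply_eq_zero hE ht hs ⟨s₁, oplus_comm hd⟩ fun i => by
    have hsum := (hull sim (t i)).map_oplus hd
    have hsim' := hE.isDER.toIsSKCongruence.map_sim (hull_mem_splitting hE (t i)) hsim
    rw [hull_apply_orthosum hE ht hs] at hsum hsim'
    rw [htF i _ ⟨_, hsum⟩ hsim'] at hsum
    exact eq_zero_of_oplus_eq hsum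
  rw [hd₀, oplus_zero] at hd
  exact Option.some.inj hd

theorem isStronglyTypeDetermining_finiteElements (hE : IsDGEA sim) :
    IsStronglyTypeDetermining (hull sim) (finiteElements sim) :=
  ⟨isOrderIdeal_finiteElements hE.isDER.toIsSKCongruence,
    (subset_bracket _ _).antisymm (bracket_finiteElements_subset hE)⟩

/-! ### Invariant elements -/

theorem Iic_subset_summand_hull (hE : IsDGEA sim) (c : E) :
    Set.Iic c ⊆ (hull sim c).summand := fun _ hx =>
  Exocenter.mem_summand_iff.2 ((hull sim c).fixed_of_le hx (hull_self hE c))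

theorem mem_hullInvariantElements_iff (hE : IsDGEA sim) {c : E} :
    c ∈ hullInvariantElements (hull sim) ↔ ∀ x, hull sim c x = x → x ≤ c := by
  constructor
  · intro h x hx
    exact (h.le : (hull sim c).summand ⊆ Set.Iic c) (Exocenter.mem_summand_iff.2 hx)
  · intro h
    exact Set.Subset.antisymm (fun x hx => h x (Exocenter.mem_summand_iff.1 hx))
      (Iic_subset_summand_hull hE c)

/-- Otherwise (SK4a') yields a splitting mapping that fixes `c` and kills `d`. It lies above the
hull of `c`, which then kills `d` too. -/
theorem related_of_hull_apply_ne_zero (hE : IsDGEA sim) {c d : E} (h : hull sim c d ≠ 0) :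
    Related sim c d := by
  by_contra hr
  obtain ⟨π, hπ, hc, hd⟩ := hE.isDER.sk4a' c d hr
  rw [Exocenter.mem_summand_iff] at hc
  rw [Exocenter.mem_coSummand_iff] at hd
  rw [← hull_le hE hπ hc d, hd, Exocenter.map_zero] at h
  exact h rfl

theorem invariantElements_eq (hE : IsDGEA sim) :
    invariantElements sim = hullInvariantElements (hull sim) := by
  have hsim := hE.isDER.toIsSKCongruence
  ext c
  rw [mem_hullInvariantElements_iff hE]
  constructor
  · rintro ⟨-, hc⟩ x hx
    by_contra hxc
    -- As `e` lies in the hull of `c`, its nonzero copy `d` is not killed by this hull. So `d` is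
    -- related to `c` although `d ⊥ c`, which contradicts invariance.
    obtain ⟨e, d, -, hd, hex, hed, hdc⟩ := hsim.sk4b x c hxc
    have hfix : hull sim c e = e := (hull sim c).fixed_of_le hex hx
    have hcd : hull sim c d ≠ 0 := fun h₀ => hd
      (mem_splitting_iff.1 (hull_mem_splitting hE c) e d hfix h₀ hed).2
    obtain ⟨u, v, hu, -, huc, huv, hvd⟩ := related_of_hull_apply_ne_zero hE hcd
    obtain ⟨s, hs⟩ := hdc
    obtain ⟨w, hw, -⟩ := exists_oplus_of_le hvd le_rfl hs
    exact hu (hc u v huc huv ⟨w, hw⟩).1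
  · intro hc
    have hfix : ∀ {x}, x ≤ c → hull sim c x = x := fun hx =>
      (hull sim c).fixed_of_le hx (hull_self hE c)
    have hadd : ∀ {x y s}, hull sim c x = x → hull sim c y = y → oplus x y = some s → s ≤ c :=
      fun {x y s} hx hy hs => hc s (by
        have h := (hull sim c).map_oplus hs
        rw [hx, hy, hs] at h
        exact (Option.some.inj h).symm)
    refine ⟨fun e f s he hf hs => hadd (hfix he) (hfix hf) hs, fun e f he hef ⟨s, hs⟩ => ?_⟩
    -- The summand of a splitting mapping is closed under `sim`. Then `f ⊕ c` also lies in the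
    -- summand, hence below `c`, and so `f = 0`.
    have hf : hull sim c f = f := by
      have hη := mem_splitting_iff.1 (hull_mem_splitting hE c)
      obtain ⟨g, hge, hg⟩ := hsim.exists_sim_of_le hef ((hull sim c).compl.decr f)
      exact Exocenter.compl_eq_zero_iff.1
        (hη g _ (hfix (hge.trans he)) (Exocenter.apply_compl _ f) hg).2
    have hf₀ : f = 0 := eq_zero_of_oplus_le (oplus_comm hs) (hadd hf (hull_self hE c) hs)
    exact ⟨hsim.sk1 e (hf₀ ▸ hef), hf₀⟩

theorem bracket_hullInvariantElements_subset (hE : IsDGEA sim) :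
    bracket (hull sim) (hullInvariantElements (hull sim)) ⊆ hullInvariantElements (hull sim) := by
  rintro s ⟨I, t, htc, ht, hs⟩
  refine (mem_hullInvariantElements_iff hE).2 fun x hx => ?_
  obtain ⟨σ, hσ, hσs, hσfix⟩ := exists_sup_hull hE ht hs
  have hσx : σ x = x := by
    have h := hull_le hE hσ hσfix x
    rwa [Exocenter.comm_apply, hx] at h
  rw [← hσx]
  refine (isOrthosum_iff.1 (hσs x)).2 s fun S r hr => ?_
  have hle : ∀ i, hull sim (t i) x ≤ t i := fun i =>
    (mem_hullInvariantElements_iff hE).1 (htc i) _ ((hull sim (t i)).idem x)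
  choose d hd using hle
  obtain ⟨v, hv, hvs⟩ := (isOrthosum_iff.1 hs).1 S
  have hsum : ∑ i ∈ S, some (hull sim (t i) x) + ∑ i ∈ S, some (d i) = some v := by
    rw [← Finset.sum_add_distrib, ← hv]
    exact Finset.sum_congr rfl fun i _ => hd i
  rw [hr] at hsum
  exact (le_of_some_add hsum).trans hvs

/-- The hull of `η_e t` lies below the splitting mapping `η_e ∘ η_t`, so any `x` it fixes equals
`η_e (η_t x)`, and `η_t x ≤ t`. -/
theorem hull_apply_mem_hullInvariantElements (hE : IsDGEA sim) (e : E) {t : E}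
    (ht : t ∈ hullInvariantElements (hull sim)) :
    hull sim e t ∈ hullInvariantElements (hull sim) := by
  rw [mem_hullInvariantElements_iff hE] at ht ⊢
  intro x hx
  have hcomp := hE.isDER.toIsSKCongruence.comp_mem_splitting (hull_mem_splitting hE e)
    (hull_mem_splitting hE t)
  have hle := hull_le hE (e := hull sim e t) hcomp (by
    rw [Exocenter.comp_apply, Exocenter.comm_apply (hull sim t), hull_self hE, Exocenter.idem])
  have h₁ : hull sim e (hull sim t x) = x := by
    have h := hle x
    rw [Exocenter.comm_apply, hx, Exocenter.comp_apply] at h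
    exact h
  rw [← h₁]
  exact (hull sim e).map_mono (ht _ ((hull sim t).idem x))

theorem isTypeDetermining_finiteInvariantElements (hE : IsDGEA sim) :
    IsTypeDetermining (hull sim) (finiteInvariantElements sim) := by
  refine ⟨(subset_bracket _ _).antisymm ?_, Set.Subset.antisymm
    (fun t ht => ⟨t, t, ht, (hull_self hE t).symm⟩) ?_⟩
  · rintro s ⟨I, t, htT, ht, hs⟩
    refine ⟨bracket_finiteElements_subset hE ⟨I, t, fun i => (htT i).1, ht, hs⟩, ?_⟩
    rw [invariantElements_eq hE]
    exact bracket_hullInvariantElements_subset hE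
      ⟨I, t, fun i => invariantElements_eq hE ▸ (htT i).2, ht, hs⟩
  · rintro s ⟨e, t, ht, rfl⟩
    refine ⟨(isOrderIdeal_finiteElements hE.isDER.toIsSKCongruence).2 t ht.1 _ (Exocenter.decr _ t),
      ?_⟩
    rw [invariantElements_eq hE]
    exact hull_apply_mem_hullInvariantElements hE e (invariantElements_eq hE ▸ ht.2)

end GEA

theorem mainTheorem4 {E : Type u} [GEA E] (sim : E → E → Prop) (hE : GEA.IsDGEA sim) :
    GEA.IsHullSystemOf (GEA.splitting sim) (GEA.hull sim) ∧
    (GEA.IsOrderIdeal (GEA.simpleElements sim) ∧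
      GEA.IsHereditary sim (GEA.simpleElements sim) ∧
      GEA.IsStronglyTypeDetermining (GEA.hull sim) (GEA.simpleElements sim)) ∧
    (GEA.IsIdeal (GEA.finiteElements sim) ∧
      GEA.IsHereditary sim (GEA.finiteElements sim) ∧
      GEA.IsStronglyTypeDetermining (GEA.hull sim) (GEA.finiteElements sim)) ∧
    (GEA.finiteInvariantElements sim =
        GEA.finiteElements sim ∩ GEA.hullInvariantElements (GEA.hull sim) ∧
      GEA.IsTypeDetermining (GEA.hull sim) (GEA.finiteInvariantElements sim)) :=
  have hsim := hE.isDER.toIsSKCongruence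
  ⟨GEA.isHullSystemOf_hull hE,
    ⟨GEA.isOrderIdeal_simpleElements, GEA.isHereditary_simpleElements hsim,
      GEA.isStronglyTypeDetermining_simpleElements hE⟩,
    ⟨GEA.isIdeal_finiteElements hE, GEA.isHereditary_finiteElements hsim,
      GEA.isStronglyTypeDetermining_finiteElements hE⟩,
    congrArg (GEA.finiteElements sim ∩ ·) (GEA.invariantElements_eq hE),
    GEA.isTypeDetermining_finiteInvariantElements hE⟩
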